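/- Let $G$ and $H$ be graphs, with vertex sets $V$ and $W$, whose undirected edges are labeled by $n$ labels and which have distinguished vertices $d_1,\dots,d_h\in V$ and $e_1,\dots,e_h\in W$ respectively; two vertices may be joined by edges with different labels, and $H$ may be infinite. For binary relations $R_1,\dots,R_n$ on a set $A$, let $G(R_1,\dots,R_n)$ be the set of all $(a_1,\dots,a_h)\in A^h$ for which there is a function $c\colon V\to A$ with $c(d_k)=a_k$ for $k=1,\dots,h$ and with $c(v)\mathrel{R_i}c(v')$ whenever $v,v'$ are connected by an edge with the $i$-th label; define $H(R_1,\dots,R_n)$ similarly. Call $G$ regular if $V$ is finite and, for each $i$, every class of the least equivalence relation on $V$ that relates any two vertices connected by an edge with the $i$-th label has at most $2$ elements. For binary relations $\beta,\gamma$ and $m\ge 1$, let $\beta\circ_m\gamma=\beta\circ\gamma\circ\beta\circ\cdots$ with $m$ factors, alternately $\beta$ and $\gamma$. Let $\mathcal V$ be a variety of algebras and suppose that $G$ is regular. Then the following are equivalent. (i) $G(\alpha_1,\dots,\alpha_n)\subseteq H(\alpha_1,\dots,\alpha_n)$ for every algebra $A\in\mathcal V$ and all congruences $\alpha_1,\dots,\alpha_n$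 of $A$. (ii) $G(\beta_1\circ\gamma_1\circ\beta_1,\dots,\beta_n\circ\gamma_n\circ\beta_n)\subseteq H(\beta_1\circ\gamma_1\circ\beta_1,\dots,\beta_n\circ\gamma_n\circ\beta_n)$ for every $A\in\mathcal V$ and all congruences $\beta_1,\gamma_1,\dots,\beta_n,\gamma_n$ of $A$. (iii) For every odd $m\ge 1$, $G(\beta_1\circ_m\gamma_1,\dots,\beta_n\circ_m\gamma_n)\subseteq H(\beta_1\circ_m\gamma_1,\dots,\beta_n\circ_m\gamma_n)$ for every $A\in\mathcal V$ and all congruences $\beta_1,\gamma_1,\dots,\beta_n,\gamma_n$ of $A$. (iv) For some odd $m\ge 1$, the inclusion in (iii) holds for every $A\in\mathcal V$ and all congruences $\beta_1,\gamma_1,\dots,\beta_n,\gamma_n$ of $A$. -/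

import Mathlib

universe u v w

namespace GraphInclusion

open FirstOrder

/-- A graph with vertex set `V`, with (undirected) edges labeled by `n` labels and with `h`
distinguished vertices. Two vertices may be connected by edges with several different labels. -/
structure LabeledGraph (V : Type*) (n h : ℕ) where
  /-- `adj i v w`: the vertices `v` and `w` are connected by an edge with the `i`-th label. -/
  adj : Fin n → V → V → Prop
  adj_symm : ∀ i v w, adj i v w → adj i w v
  /-- The distinguished vertices. -/
  dist : Fin h → V

namespace LabeledGraph

variable {V W : Type*} {n h : ℕ}

/-- The least equivalence relation on the vertices relating any two vertices which are
connected by an edge with the `i`-th label. -/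
def sim (G : LabeledGraph V n h) (i : Fin n) : V → V → Prop :=
  Relation.EqvGen (G.adj i)

/-- A graph is regular if it is finite and, for every label, all the equivalence classes of the
associated equivalence relation have at most two elements. -/
def IsRegular (G : LabeledGraph V n h) : Prop :=
  Finite V ∧ ∀ (i : Fin n) (x : V), {y : V | G.sim i x y}.encard ≤ 2

/-- The `h`-ary relation `G(R₁, …, Rₙ)` on `A`: the tuples that can be connected by `G`. -/
def rel {A : Type*} (G : LabeledGraph V n h) (R : Fin n → A → A → Prop) (a : Fin h → A) : Prop :=
  ∃ c : V → A, (∀ k, a k = c (G.dist k)) ∧ ∀ i x y, G.adj i x y → R i (c x) (c y)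

/-- The inclusion `G(R₁, …, Rₙ) ⊆ H(R₁, …, Rₙ)`. -/
def Incl {A : Type*} (G : LabeledGraph V n h) (H : LabeledGraph W n h)
    (R : Fin n → A → A → Prop) : Prop :=
  ∀ a : Fin h → A, G.rel R a → H.rel R a

end LabeledGraph

/-- `A` belongs to the variety defined by the set `E` of identities (pairs of terms). -/
def InVariety {L : FirstOrder.Language.{u, v}} (E : Set (L.Term ℕ × L.Term ℕ))
    (A : Type*) [L.Structure A] : Prop :=
  ∀ e ∈ E, ∀ x : ℕ → A, e.1.realize x = e.2.realize x

/-- A congruence of the algebra `A`: an equivalence relation compatible with all operations. -/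
structure IsCongruence (L : FirstOrder.Language.{u, v}) {A : Type*} [L.Structure A]
    (r : A → A → Prop) : Prop where
  equivalence : Equivalence r
  compatible : ∀ {k : ℕ} (f : L.Functions k) (x y : Fin k → A), (∀ j, r (x j) (y j)) →
    r (Language.Structure.funMap f x) (Language.Structure.funMap f y)

/-- `altComp β γ m` is `β ∘ₘ γ`, that is, `β ∘ γ ∘ β ∘ ⋯` with `m` factors. -/
def altComp {A : Type*} (β γ : A → A → Prop) : ℕ → A → A → Prop
  | 0 => Eq
  | m + 1 => Relation.Comp β (altComp γ β m)

end GraphInclusion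

/-!
With an odd number of factors, `β ∘ₘ γ` has the form `R ∘ R⁻¹` with `R` reflexive and compatible,
so it suffices to pass from congruences to relations `Rᵢ ∘ Rᵢ⁻¹`. For this, let `B` be the
subalgebra of `Aⁿ⁺¹` consisting of the tuples `(p, q₁, …, qₙ)` with `p Rᵢ qᵢ` for all `i`, and let
`αᵢ` be the kernel of the projection to `qᵢ`. If two elements of `B` are related by `αᵢ`, then their
first coordinates are related by `Rᵢ ∘ Rᵢ⁻¹`. Conversely, since the `i`-classes of `G` have at most
two elements, the vertices of such a class, when colored by elements pairwise related by
`Rᵢ ∘ Rᵢ⁻¹`, can be given the same coordinate `qᵢ`; hence every coloring of `G` by elements of `A`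
lifts to a coloring by elements of `B`. Applying the inclusion for congruences in `B` and projecting
back to `A` gives the inclusion for `Rᵢ ∘ Rᵢ⁻¹`.
-/

namespace GraphInclusion

open FirstOrder FirstOrder.Language Relation

section AltComp

variable {A : Type*} {β γ r : A → A → Prop}

theorem altComp_three (β γ : A → A → Prop) : altComp β γ 3 = Comp β (Comp γ β) := by
  simp only [altComp, comp_eq]

theorem altComp_self (hβ : Equivalence β) (m : ℕ) : altComp β β (m + 1) = β := by
  induction m with
  | zero => exact comp_eq
  | succ m ih =>
    rw [altComp, ih]
    ext x y
    exact ⟨fun ⟨_, hxz, hzy⟩ => hβ.trans hxz hzy, fun hxy => ⟨x, hβ.refl x, hxy⟩⟩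

theorem altComp_refl (hβ : ∀ x, β x x) (hγ : ∀ x, γ x x) (m : ℕ) (x : A) :
    altComp β γ m x x := by
  induction m generalizing β γ with
  | zero => rfl
  | succ m ih => exact ⟨x, hβ x, ih hγ hβ⟩

theorem altComp_two_mul_add_two (β γ : A → A → Prop) (k : ℕ) :
    altComp β γ (2 * k + 2) = Comp (altComp β γ (2 * k + 1)) γ := by
  induction k with
  | zero => simp only [altComp, comp_eq]
  | succ k ih =>
    calc altComp β γ (2 * k + 2 + 2)
      _ = Comp β (Comp γ (Comp (altComp β γ (2 * k + 1)) γ)) := by rw [← ih]; rfl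
      _ = Comp (Comp β (Comp γ (altComp β γ (2 * k + 1)))) γ := by simp only [comp_assoc]

theorem join_eq_self_of_equivalence (hβ : Equivalence β) : Join β = β := by
  ext x y
  exact ⟨fun ⟨_, hxz, hyz⟩ => hβ.trans hxz (hβ.symm hyz), fun hxy => ⟨y, hxy, hβ.refl y⟩⟩

theorem join_comp (hβ : ∀ {x y}, β x y → β y x) :
    Join (Comp β r) = Comp β (Comp (Join r) β) := by
  ext x y
  constructor
  · rintro ⟨z, ⟨s, hxs, hsz⟩, ⟨t, hyt, htz⟩⟩
    exact ⟨s, hxs, t, ⟨z, hsz, htz⟩, hβ hyt⟩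
  · rintro ⟨s, hxs, t, ⟨z, hsz, htz⟩, hty⟩
    exact ⟨z, ⟨s, hxs, hsz⟩, ⟨t, hβ hty, htz⟩⟩

theorem altComp_two_mul_add_one_eq_join (hβ : Equivalence β) (hγ : Equivalence γ) (k : ℕ) :
    altComp β γ (2 * k + 1) = Join (altComp β γ (k + 1)) := by
  induction k generalizing β γ with
  | zero => simp only [altComp, comp_eq, join_eq_self_of_equivalence hβ]
  | succ k ih =>
    calc altComp β γ (2 * k + 3)
      _ = Comp β (Comp (altComp γ β (2 * k + 1)) β) := by rw [← altComp_two_mul_add_two]; rfl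
      _ = Comp β (Comp (Join (altComp γ β (k + 1))) β) := by rw [ih hγ hβ]
      _ = Join (altComp β γ (k + 2)) := (join_comp hβ.symm).symm

end AltComp

section IsCompatible

variable {L : FirstOrder.Language.{u, v}} {A : Type*} [L.Structure A] {β γ : A → A → Prop}

/-- The relation `r` is preserved by all operations of the algebra `A`, that is, `r` is a
subalgebra of `A × A`. -/
def IsCompatible (L : FirstOrder.Language.{u, v}) {A : Type*} [L.Structure A]
    (r : A → A → Prop) : Prop :=
  ∀ {k : ℕ} (f : L.Functions k) (x y : Fin k → A), (∀ j, r (x j) (y j)) →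
    r (Structure.funMap f x) (Structure.funMap f y)

theorem IsCompatible.comp (hβ : IsCompatible L β) (hγ : IsCompatible L γ) :
    IsCompatible L (Comp β γ) := by
  intro k f x y hxy
  choose z hxz hzy using hxy
  exact ⟨Structure.funMap f z, hβ f x z hxz, hγ f z y hzy⟩

theorem IsCompatible.altComp (hβ : IsCompatible L β) (hγ : IsCompatible L γ) (m : ℕ) :
    IsCompatible L (altComp β γ m) := by
  induction m generalizing β γ with
  | zero => exact fun f x y hxy => congrArg (Structure.funMap f) (funext hxy)
  | succ m ih => exact hβ.comp (ih hγ hβ)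

end IsCompatible

section Subpowers

variable {L : FirstOrder.Language.{u, v}}

/-- The product of a family of structures, with operations and relations defined coordinatewise. -/
instance piStructure {ι : Type*} {M : ι → Type*} [∀ i, L.Structure (M i)] :
    L.Structure (∀ i, M i) where
  funMap f x i := Structure.funMap f fun j => x j i
  RelMap r x := ∀ i, Structure.RelMap r fun j => x j i

/-- The projection of a product of structures to the coordinate `i`. -/
def evalHom {ι : Type*} {M : ι → Type*} [∀ i, L.Structure (M i)] (i : ι) :
    (∀ i, M i) →[L] M i where
  toFun p := p i
  map_fun' _ _ := rfl
  map_rel' _ _ h := h i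

/-- The class `K` contains all subalgebras of finite powers of its members. Besides varieties, all
quasivarieties and pseudovarieties have this closure property. -/
def ClosedUnderFiniteSubpowers (K : (A : Type w) → [L.Structure A] → Prop) : Prop :=
  ∀ (A : Type w) [L.Structure A], K A →
    ∀ (ι : Type) [Finite ι] (S : L.Substructure (ι → A)), K S

theorem InVariety.of_subpower {E : Set (L.Term ℕ × L.Term ℕ)} {A : Type*} [L.Structure A]
    (hA : InVariety E A) {ι : Type*} (S : L.Substructure (ι → A)) : InVariety E S := by
  intro e he x
  ext i
  let π : S →[L] A := (evalHom i).comp S.subtype.toHom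
  calc π (e.1.realize x)
    _ = e.1.realize (π ∘ x) := (HomClass.realize_term π).symm
    _ = e.2.realize (π ∘ x) := hA e he _
    _ = π (e.2.realize x) := HomClass.realize_term π

theorem closedUnderFiniteSubpowers_inVariety (E : Set (L.Term ℕ × L.Term ℕ)) :
    ClosedUnderFiniteSubpowers fun (A : Type w) [L.Structure A] => InVariety E A :=
  fun _ _ hA _ _ S => hA.of_subpower S

end Subpowers

section RelatedTuples

variable {L : FirstOrder.Language.{u, v}} {A ι : Type*} [L.Structure A] {R : ι → A → A → Prop}

/-- The subalgebra of the tuples `(p, (qᵢ)ᵢ)` with `R i p qᵢ` for all `i`. The entry `p` is stored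
at the index `none` and `qᵢ` at the index `some i`. -/
def relatedTuples (R : ι → A → A → Prop) (hR : ∀ i, IsCompatible L (R i)) :
    L.Substructure (Option ι → A) where
  carrier := {p | ∀ i, R i (p none) (p (some i))}
  fun_mem f _ hx i := hR i f _ _ fun j => hx j i

/-- The kernel of the projection of `relatedTuples R hR` to the coordinate `i`. -/
def coordKer (hR : ∀ i, IsCompatible L (R i)) (i : ι) (p q : relatedTuples R hR) : Prop :=
  p.1 (some i) = q.1 (some i)

theorem isCongruence_coordKer (hR : ∀ i, IsCompatible L (R i)) (i : ι) :
    IsCongruence L (coordKer hR i) where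
  equivalence := ⟨fun _ => rfl, Eq.symm, Eq.trans⟩
  compatible f _ _ hxy := congrArg (Structure.funMap f) (funext hxy)

theorem join_of_coordKer {hR : ∀ i, IsCompatible L (R i)} {i : ι} {p q : relatedTuples R hR}
    (hpq : coordKer hR i p q) : Join (R i) (p.1 none) (q.1 none) :=
  ⟨p.1 (some i), p.2 i, hpq ▸ q.2 i⟩

end RelatedTuples

theorem exists_forall_rel_of_encard_le_two {A : Type*} {R : A → A → Prop} {s : Set A}
    (hs : s.encard ≤ 2) (hne : s.Nonempty) (hR : ∀ a ∈ s, ∀ b ∈ s, Join R a b) :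
    ∃ z, ∀ a ∈ s, R a z := by
  obtain ⟨a, ha⟩ := hne
  obtain ⟨b, hb, hsab⟩ : ∃ b ∈ s, s ⊆ {a, b} := by
    by_cases hsub : s ⊆ {a}
    · exact ⟨a, ha, hsub.trans (by simp)⟩
    · obtain ⟨b, hb, hba : b ≠ a⟩ := Set.not_subset.1 hsub
      have hab : ({a, b} : Set A) = s :=
        (Set.toFinite _).eq_of_subset_of_encard_le (Set.pair_subset ha hb)
          (hs.trans (Set.encard_pair hba.symm).ge)
      exact ⟨b, hb, hab.ge⟩
  obtain ⟨z, haz, hbz⟩ := hR a ha b hb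
  refine ⟨z, fun x hx => ?_⟩
  rcases hsab hx with rfl | rfl
  exacts [haz, hbz]

namespace LabeledGraph

variable {V W : Type*} {n h : ℕ} {G : LabeledGraph V n h}

theorem rel.map {A B : Type*} {R : Fin n → A → A → Prop} {S : Fin n → B → B → Prop}
    {a : Fin h → A} (ha : G.rel R a) (f : A → B) (hf : ∀ i x y, R i x y → S i (f x) (f y)) :
    G.rel S (f ∘ a) := by
  obtain ⟨c, hac, hc⟩ := ha
  exact ⟨f ∘ c, fun k => congrArg f (hac k), fun i x y hxy => hf i _ _ (hc i x y hxy)⟩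

theorem eq_or_adj_of_sim {i : Fin n} (hG : ∀ x, {y | G.sim i x y}.encard ≤ 2) {x y : V}
    (hxy : G.sim i x y) : x = y ∨ G.adj i x y := by
  induction hxy with
  | rel x y hxy => exact .inr hxy
  | refl x => exact .inl rfl
  | symm x y _ ih => exact ih.imp Eq.symm (G.adj_symm i x y)
  | trans x y z hxy hyz ihxy ihyz =>
    by_contra! hxz
    have hne_xy : x ≠ y := by grind
    have hne_yz : y ≠ z := by grind
    have hsub : {x, y, z} ⊆ {y | G.sim i x y} := by
      rintro _ (rfl | rfl | rfl)
      exacts [.refl _, hxy, hxy.trans _ _ _ hyz]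
    have hcard : ({x, y, z} : Set V).encard = 3 :=
      Set.encard_eq_three.2 ⟨x, y, z, hne_xy, hxz.1, hne_yz, rfl⟩
    exact absurd (hcard.ge.trans ((Set.encard_le_encard hsub).trans (hG x))) (by decide)

theorem exists_common_bound {i : Fin n} (hG : ∀ x, {y | G.sim i x y}.encard ≤ 2) {A : Type*}
    {R : A → A → Prop} (hR : ∀ x, R x x) {c : V → A}
    (hc : ∀ x y, G.adj i x y → Join R (c x) (c y)) :
    ∃ b : V → A, (∀ x, R (c x) (b x)) ∧ ∀ x y, G.adj i x y → b x = b y := by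
  have hclass (x : V) : ∃ z, ∀ y, G.sim i x y → R (c y) z := by
    have hjoin : ∀ a ∈ c '' {y | G.sim i x y}, ∀ b ∈ c '' {y | G.sim i x y}, Join R a b := by
      rintro _ ⟨y, hxy, rfl⟩ _ ⟨z, hxz, rfl⟩
      rcases eq_or_adj_of_sim hG ((hxy.symm _ _).trans _ _ _ hxz) with rfl | hyz
      exacts [⟨c y, hR _, hR _⟩, hc y z hyz]
    obtain ⟨z, hz⟩ := exists_forall_rel_of_encard_le_two
      ((Set.encard_image_le c _).trans (hG x)) ⟨c x, x, .refl x, rfl⟩ hjoin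
    exact ⟨z, fun y hxy => hz _ ⟨y, hxy, rfl⟩⟩
  have hquot (q : Quot (G.adj i)) : ∃ z, ∀ y, Quot.mk _ y = q → R (c y) z := by
    obtain ⟨x, rfl⟩ := q.exists_rep
    exact (hclass x).imp fun z hz y hyx => hz y (Quot.eqvGen_exact hyx.symm)
  choose g hg using hquot
  exact ⟨fun x => g (Quot.mk _ x), fun x => hg _ x rfl, fun x y hxy => congrArg g (Quot.sound hxy)⟩

variable {L : FirstOrder.Language.{u, v}}

theorem exists_rel_coordKer_of_rel_join (hG : ∀ i x, {y | G.sim i x y}.encard ≤ 2) {A : Type*}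
    [L.Structure A] {R : Fin n → A → A → Prop} (hrefl : ∀ i x, R i x x)
    (hR : ∀ i, IsCompatible L (R i)) {a : Fin h → A} (ha : G.rel (fun i => Join (R i)) a) :
    ∃ p : Fin h → relatedTuples R hR, G.rel (coordKer hR) p ∧ ∀ k, (p k).1 none = a k := by
  obtain ⟨c, hac, hc⟩ := ha
  choose b hcb hb using fun i => exists_common_bound (hG i) (hrefl i) (hc i)
  let d (x : V) : relatedTuples R hR := ⟨fun o => o.elim (c x) (b · x), fun i => hcb i x⟩
  exact ⟨d ∘ G.dist, ⟨d, fun _ => rfl, hb⟩, fun k => (hac k).symm⟩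

theorem incl_join_of_incl_congruences {K : (A : Type w) → [L.Structure A] → Prop}
    (hK : ClosedUnderFiniteSubpowers K) (hG : ∀ i x, {y | G.sim i x y}.encard ≤ 2)
    {H : LabeledGraph W n h}
    (hincl : ∀ (A : Type w) [L.Structure A] [Nonempty A], K A →
      ∀ α : Fin n → A → A → Prop, (∀ i, IsCongruence L (α i)) → G.Incl H α)
    {A : Type w} [L.Structure A] [Nonempty A] (hA : K A)
    {R : Fin n → A → A → Prop} (hrefl : ∀ i x, R i x x) (hR : ∀ i, IsCompatible L (R i)) :
    G.Incl H fun i => Join (R i) := by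
  intro a ha
  obtain ⟨p, hp, hpa⟩ := exists_rel_coordKer_of_rel_join hG hrefl hR ha
  have : Nonempty (relatedTuples R hR) :=
    ‹Nonempty A›.map fun x => ⟨fun _ => x, fun i => hrefl i x⟩
  have hHp : H.rel (coordKer hR) p :=
    hincl _ (hK A hA _ (relatedTuples R hR)) _ (isCongruence_coordKer hR) p hp
  rw [← funext hpa]
  exact hHp.map (fun q => q.1 none) fun _ _ _ => join_of_coordKer

end LabeledGraph

end GraphInclusion

open GraphInclusion FirstOrder in
theorem corollary4_general {L : FirstOrder.Language.{u, v}}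
    {K : (A : Type w) → [L.Structure A] → Prop} (hK : ClosedUnderFiniteSubpowers K)
    {n h : ℕ} {V W : Type*} (G : LabeledGraph V n h) (H : LabeledGraph W n h)
    (hG : ∀ i x, {y | G.sim i x y}.encard ≤ 2) :
    List.TFAE [
      ∀ (A : Type w) [L.Structure A] [Nonempty A], K A →
        ∀ α : Fin n → A → A → Prop, (∀ i, IsCongruence L (α i)) →
          G.Incl H α,
      ∀ (A : Type w) [L.Structure A] [Nonempty A], K A →
        ∀ β γ : Fin n → A → A → Prop, (∀ i, IsCongruence L (β i)) → (∀ i, IsCongruence L (γ i)) →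
          G.Incl H (fun i => Relation.Comp (β i) (Relation.Comp (γ i) (β i))),
      ∀ m : ℕ, Odd m →
        ∀ (A : Type w) [L.Structure A] [Nonempty A], K A →
        ∀ β γ : Fin n → A → A → Prop, (∀ i, IsCongruence L (β i)) → (∀ i, IsCongruence L (γ i)) →
          G.Incl H (fun i => altComp (β i) (γ i) m),
      ∃ m : ℕ, Odd m ∧
        ∀ (A : Type w) [L.Structure A] [Nonempty A], K A →
        ∀ β γ : Fin n → A → A → Prop, (∀ i, IsCongruence L (β i)) → (∀ i, IsCongruence L (γ i)) →
          G.Incl H (fun i => altComp (β i) (γ i) m)] := by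
  tfae_have 1 → 3 := by
    rintro hcong _ ⟨k, rfl⟩ A _ _ hA β γ hβ hγ
    have hjoin : G.Incl H fun i => Relation.Join (altComp (β i) (γ i) (k + 1)) :=
      LabeledGraph.incl_join_of_incl_congruences hK hG hcong hA
        (fun i => altComp_refl (hβ i).equivalence.refl (hγ i).equivalence.refl _)
        (fun i => IsCompatible.altComp (hβ i).compatible (hγ i).compatible _)
    simpa only [altComp_two_mul_add_one_eq_join (hβ _).equivalence (hγ _).equivalence] using hjoin
  tfae_have 3 → 2 := fun hodd => by
    simpa only [altComp_three] using hodd 3 (by decide)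
  tfae_have 2 → 4 := fun hthree =>
    ⟨3, by decide, by simpa only [altComp_three] using hthree⟩
  tfae_have 4 → 1 := by
    rintro ⟨_, ⟨k, rfl⟩, halt⟩ A _ _ hA α hα
    simpa only [altComp_self (hα _).equivalence] using halt A hA α α hα hα
  tfae_finish

open GraphInclusion FirstOrder in
theorem corollary4 {L : FirstOrder.Language.{u, v}} [L.IsAlgebraic] (E : Set (L.Term ℕ × L.Term ℕ))
    {n h : ℕ} {V : Type*} {W : Type*} (G : LabeledGraph V n h) (H : LabeledGraph W n h)
    (hG : G.IsRegular) :
    List.TFAE [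
      -- (i)
      ∀ (A : Type (max u w)) [L.Structure A] [Nonempty A], InVariety E A →
        ∀ α : Fin n → A → A → Prop, (∀ i, IsCongruence L (α i)) →
          G.Incl H α,
      -- (ii)
      ∀ (A : Type (max u w)) [L.Structure A] [Nonempty A], InVariety E A →
        ∀ β γ : Fin n → A → A → Prop, (∀ i, IsCongruence L (β i)) → (∀ i, IsCongruence L (γ i)) →
          G.Incl H (fun i => Relation.Comp (β i) (Relation.Comp (γ i) (β i))),
      -- (iii), for every odd m
      ∀ m : ℕ, Odd m →
        ∀ (A : Type (max u w)) [L.Structure A] [Nonempty A], InVariety E A →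
        ∀ β γ : Fin n → A → A → Prop, (∀ i, IsCongruence L (β i)) → (∀ i, IsCongruence L (γ i)) →
          G.Incl H (fun i => altComp (β i) (γ i) m),
      -- (iii), for some odd m
      ∃ m : ℕ, Odd m ∧
        ∀ (A : Type (max u w)) [L.Structure A] [Nonempty A], InVariety E A →
        ∀ β γ : Fin n → A → A → Prop, (∀ i, IsCongruence L (β i)) → (∀ i, IsCongruence L (γ i)) →
          G.Incl H (fun i => altComp (β i) (γ i) m)] :=
  corollary4_general (closedUnderFiniteSubpowers_inVariety E) G H hG.2
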